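/- Let $L^2(\mathbb{C}, e^{-|z|^2})$ be the Hilbert space of (classes of) measurable functions $f:\mathbb{C}\to\mathbb{C}$ with $\|f\|_\varphi^2=\int_{\mathbb{C}} |f|^2 e^{-|z|^2}\,d\sigma<\infty$, where $\sigma$ is Lebesgue measure on $\mathbb{C}$, and let $\partial=\tfrac12(\partial_x-i\partial_y)$, $\bar\partial=\tfrac12(\partial_x+i\partial_y)$. Let $k\ge 1$ be an integer, $\alpha\in\mathbb{R}$ with $|\alpha|\ge 1$, and $c\in\mathbb{C}$. Then there is a bounded linear operator $$T_k: L^2(\mathbb{C}, e^{-|z|^2})\to L^2(\mathbb{C}, e^{-|z|^2})$$ with $(\alpha\,\partial^k\bar\partial^k+c)\,T_k=I$ in the weak sense, that is, for every $f\in L^2(\mathbb{C}, e^{-|z|^2})$ the function $u=T_kf$ satisfies $$\int_{\mathbb{C}} u\,\bigl(\alpha\,\partial^k\bar\partial^k\phi+c\,\phi\bigr)\,d\sigma=\int_{\mathbb{C}} f\,\phi\,d\sigma\qquad\text{for all }\phi\in C_c^\infty(\mathbb{C},\mathbb{C}),$$ and its operator norm satisfies $$\|T_k\|_\varphi^2\le\frac{1}{(k!)^2}.$$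 -/

import Mathlib

open MeasureTheory
open scoped ContDiff

namespace WeightedDBar

/-- The Wirtinger derivative `∂f = (∂f/∂x - i ∂f/∂y) / 2` of `f : ℂ → ℂ`. -/
noncomputable def del (f : ℂ → ℂ) (z : ℂ) : ℂ :=
  (1 / 2 : ℂ) * (fderiv ℝ f z 1 - Complex.I * fderiv ℝ f z Complex.I)

/-- The Wirtinger derivative `∂̄f = (∂f/∂x + i ∂f/∂y) / 2` of `f : ℂ → ℂ`. -/
noncomputable def delBar (f : ℂ → ℂ) (z : ℂ) : ℂ :=
  (1 / 2 : ℂ) * (fderiv ℝ f z 1 + Complex.I * fderiv ℝ f z Complex.I)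

/-- The measure `e^{-|z|²} dσ` on `ℂ`, where `σ` is Lebesgue measure on the plane. -/
noncomputable def gaussianWeight : Measure ℂ :=
  (volume : Measure ℂ).withDensity fun z => ENNReal.ofReal (Real.exp (-‖z‖ ^ 2))

/-- The weighted Hilbert space `L²(ℂ, e^{-|z|²})`. -/
noncomputable abbrev WeightedL2 : Type := Lp ℂ 2 gaussianWeight

/-- `u` is a weak solution on `ℂ` of `α ∂^k ∂̄^k u + c u = f`: the equation holds against every
test function `φ ∈ C_c^∞(ℂ)`, the integrals being taken with respect to Lebesgue measure. (For
locally integrable `u` and `f` both integrands are integrable. The sign from the `2k` integrations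
by parts is `(-1)^(2k) = 1`.) -/
def IsWeakSolution (k : ℕ) (α : ℝ) (c : ℂ) (u f : ℂ → ℂ) : Prop :=
  ∀ φ : ℂ → ℂ, ContDiff ℝ ∞ φ → HasCompactSupport φ →
    ∫ z, u z * ((α : ℂ) * (del^[k] (delBar^[k] φ)) z + c * φ z) = ∫ z, f z * φ z

end WeightedDBar

/-! The argument is duality plus an a priori estimate. Embed a test function `f` in the weighted
space as `e^{|z|²} f`; its inner product with `u` is then the Lebesgue pairing of `u` with `conj f`.
After conjugating the test function, the weak equation says `⟪j (H x), u⟫ = ⟪j x, f⟫` with `H = α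
∂̄^k ∂^k + conj c`, and a solution operator of norm at most `1 / k!` exists once `k! ‖j x‖ ≤ ‖j (H
x)‖`.

The estimate is algebra of two bosonic pairs. In the embedded inner product `∂̄` and `∂` have
adjoints `a = -(∂ + z̄)` and `b = -(∂̄ + z)`, with `[a, ∂̄] = [b, ∂] = 1` and `a` commuting with `b`
and `∂`, and `b` with `∂̄`. Normal ordering turns `‖∂̄^k ∂^k x‖²` into a nonnegative combination of
the `‖b^j a^i x‖²`. Its extreme terms `(k!)² ‖x‖²` and `‖b^k a^k x‖²` suffice: the second absorbs
the cross term created by `c`, so the bound does not depend on `c`. -/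

open scoped InnerProductSpace

/-! ### Solvability by duality -/

/-- A right inverse of the adjoint of a densely defined operator which is bounded below. -/
theorem exists_clm_inner_eq_of_norm_le {V H : Type*} [AddCommGroup V] [Module ℂ V]
    [NormedAddCommGroup H] [InnerProductSpace ℂ H] [CompleteSpace H] (j s : V →ₗ[ℂ] H) {C : ℝ}
    (hC : 0 ≤ C) (hjs : ∀ x, ‖j x‖ ≤ C * ‖s x‖) :
    ∃ T : H →L[ℂ] H, ‖T‖ ≤ C ∧ ∀ x f, ⟪s x, T f⟫_ℂ = ⟪j x, f⟫_ℂ := by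
  let K : Submodule ℂ H := (LinearMap.range s).topologicalClosure
  have hsK : ∀ x, s x ∈ K := fun x =>
    (LinearMap.range s).le_topologicalClosure (LinearMap.mem_range_self s x)
  have : CompleteSpace K :=
    (Submodule.isClosed_topologicalClosure (LinearMap.range s)).completeSpace_coe
  let e : V →ₗ[ℂ] K := s.codRestrict K hsK
  have he : DenseRange e := by
    refine Subtype.dense_iff.2 fun y hy => ?_
    have hy' : y ∈ closure (LinearMap.range s : Set H) := hy
    refine closure_mono ?_ hy'
    rintro _ ⟨x, rfl⟩
    exact ⟨e x, ⟨x, rfl⟩, rfl⟩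
  have hb : ∀ x, ‖j x‖ ≤ C * ‖e x‖ := hjs
  -- The estimate makes `s x ↦ j x` well defined and bounded on the range of `s`; `R` is its
  -- extension to the closure, and its adjoint solves the equation.
  let R : K →L[ℂ] H := j.extendOfNorm e
  have hR : ‖R‖ ≤ C := LinearMap.opNorm_extendOfNorm_le he hC hb
  refine ⟨K.subtypeL ∘L ContinuousLinearMap.adjoint R, ?_, fun x f => ?_⟩
  · refine ContinuousLinearMap.opNorm_le_bound _ hC fun f => ?_
    calc ‖ContinuousLinearMap.adjoint R f‖ ≤ ‖ContinuousLinearMap.adjoint R‖ * ‖f‖ :=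
          ContinuousLinearMap.le_opNorm _ _
      _ ≤ C * ‖f‖ := by
          rw [LinearIsometryEquiv.norm_map]
          gcongr
  · have h1 : ⟪e x, ContinuousLinearMap.adjoint R f⟫_ℂ = ⟪j x, f⟫_ℂ := by
      rw [ContinuousLinearMap.adjoint_inner_right]
      congr 1
      exact LinearMap.extendOfNorm_eq he ⟨C, hb⟩ x
    exact h1

/-! ### Normal ordering for one canonical commutation relation -/

/-- The coefficients of the normal ordering of `a ^ k * a' ^ k` when `[a, a'] = 1`. -/
def normalOrderCoeff : ℕ → ℕ → ℕ
  | 0, 0 => 1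
  | 0, _ + 1 => 0
  | k + 1, 0 => (k + 1) * normalOrderCoeff k 0
  | k + 1, i + 1 => normalOrderCoeff k i + (k + 1 + (i + 1)) * normalOrderCoeff k (i + 1)

theorem normalOrderCoeff_zero_right (k : ℕ) : normalOrderCoeff k 0 = k.factorial := by
  induction k with
  | zero => rfl
  | succ k ih => rw [normalOrderCoeff, ih, Nat.factorial_succ]

theorem normalOrderCoeff_eq_zero_of_lt {k i : ℕ} (h : k < i) : normalOrderCoeff k i = 0 := by
  induction k generalizing i with
  | zero => obtain ⟨i, rfl⟩ := Nat.exists_eq_succ_of_ne_zero h.ne'; rfl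
  | succ k ih =>
    obtain ⟨i, rfl⟩ := Nat.exists_eq_succ_of_ne_zero (Nat.ne_zero_of_lt h)
    rw [normalOrderCoeff, ih (by omega), ih (by omega)]
    rfl

theorem normalOrderCoeff_self (k : ℕ) : normalOrderCoeff k k = 1 := by
  induction k with
  | zero => rfl
  | succ k ih => rw [normalOrderCoeff, ih, normalOrderCoeff_eq_zero_of_lt (Nat.lt_succ_self k), mul_zero,
    add_zero]

section Ring

variable {R : Type*} [Ring R] {a a' : R}

theorem mul_pow_of_commutator_eq_one (h : a * a' = a' * a + 1) (n : ℕ) :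
    a * a' ^ n = a' ^ n * a + n * a' ^ (n - 1) := by
  induction n with
  | zero => simp
  | succ n ih =>
    rcases n with _ | n
    · simp [h]
    · have e : a' ^ (n + 1 + 1) = a' ^ (n + 1) * a' := pow_succ _ _
      have e2 : (n + 1 - 1 : ℕ) = n := rfl
      rw [e2] at ih
      rw [e, ← mul_assoc, ih, add_mul, mul_assoc, h, mul_assoc, ← pow_succ]
      simp only [Nat.add_sub_cancel]
      push_cast
      noncomm_ring

theorem pow_mul_of_commutator_eq_one (h : a * a' = a' * a + 1) (n : ℕ) :
    a ^ n * a' = a' * a ^ n + n * a ^ (n - 1) := by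
  -- The opposite ring swaps the roles of `a` and `a'` in the commutation relation.
  have h' : MulOpposite.op a' * MulOpposite.op a
      = MulOpposite.op a * MulOpposite.op a' + 1 := by
    rw [← MulOpposite.op_mul, h, MulOpposite.op_add, MulOpposite.op_mul, MulOpposite.op_one]
  have := congrArg MulOpposite.unop (mul_pow_of_commutator_eq_one h' n)
  simp only [MulOpposite.unop_mul, MulOpposite.unop_add, MulOpposite.unop_pow,
    MulOpposite.unop_op, MulOpposite.unop_natCast] at this
  rw [this, Nat.cast_comm]

theorem pow_succ_mul_pow_succ_of_commutator_eq_one (h : a * a' = a' * a + 1) (k : ℕ) :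
    a ^ (k + 1) * a' ^ (k + 1) = a ^ k * a' ^ k * (a' * a + (k + 1 : ℕ)) := by
  have h1 := mul_pow_of_commutator_eq_one h (k + 1)
  rw [Nat.add_sub_cancel] at h1
  rw [pow_succ a, mul_assoc, h1, mul_add, mul_add, pow_succ a', ← Nat.cast_comm]
  simp only [mul_assoc, Nat.cast_comm]

/-- Moving `a ^ i` past the `a'` in `a' * a` costs `i`. With `k + 1` in place of `k`, this gives the
recursion defining `normalOrderCoeff`. -/
theorem pow_mul_pow_mul_of_commutator_eq_one (h : a * a' = a' * a + 1) (i k : ℕ) :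
    a' ^ i * a ^ i * (a' * a + (k : ℕ)) =
      a' ^ (i + 1) * a ^ (i + 1) + (k + i : ℕ) * (a' ^ i * a ^ i) := by
  have h1 : a ^ i * (a' * a) = a' * a ^ (i + 1) + i * a ^ i := by
    rcases i with _ | i
    · simp
    · rw [← mul_assoc, pow_mul_of_commutator_eq_one h, add_mul, mul_assoc, ← pow_succ,
        Nat.add_sub_cancel, mul_assoc, ← pow_succ]
  rw [mul_add, mul_assoc (a' ^ i), h1, mul_add, ← mul_assoc, ← pow_succ, ← mul_assoc,
    ← Nat.cast_comm i, ← Nat.cast_comm k]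
  push_cast
  noncomm_ring

theorem pow_mul_pow_eq_sum_normalOrderCoeff (h : a * a' = a' * a + 1) (k : ℕ) :
    a ^ k * a' ^ k =
      ∑ i ∈ Finset.range (k + 1), (normalOrderCoeff k i : R) * (a' ^ i * a ^ i) := by
  induction k with
  | zero => simp [normalOrderCoeff]
  | succ k ih =>
    rw [pow_succ_mul_pow_succ_of_commutator_eq_one h, ih, Finset.sum_mul]
    simp only [mul_assoc (normalOrderCoeff k _ : R), pow_mul_pow_mul_of_commutator_eq_one h,
      mul_add, Finset.sum_add_distrib]
    -- The second sum runs one index too far so that it lines up with the left side; its last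
    -- coefficient vanishes.
    have e1 : ∑ i ∈ Finset.range (k + 1 + 1),
        (normalOrderCoeff (k + 1) i : R) * (a' ^ i * a ^ i) =
        ∑ i ∈ Finset.range (k + 1), (normalOrderCoeff k i : R) * (a' ^ (i + 1) * a ^ (i + 1)) +
        ∑ i ∈ Finset.range (k + 1 + 1),
          (normalOrderCoeff k i : R) * ((k + 1 + i : ℕ) * (a' ^ i * a ^ i)) := by
      rw [Finset.sum_range_succ', Finset.sum_range_succ' _ (k + 1), ← add_assoc,
        ← Finset.sum_add_distrib]
      congr 1
      · refine Finset.sum_congr rfl fun i _ => ?_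
        rw [normalOrderCoeff, ← mul_assoc (normalOrderCoeff k (i + 1) : R), Nat.cast_add, add_mul,
          Nat.cast_mul, (Nat.cast_commute (k + 1 + (i + 1)) _).eq]
      · rw [normalOrderCoeff, ← mul_assoc (normalOrderCoeff k 0 : R), Nat.cast_mul, Nat.cast_comm,
          add_zero]
    rw [e1, Finset.sum_range_succ _ (k + 1), normalOrderCoeff_eq_zero_of_lt (Nat.lt_succ_self k)]
    simp

end Ring

/-! ### The a priori estimate -/

section LowerBound

variable {V H : Type*} [AddCommGroup V] [Module ℂ V] [NormedAddCommGroup H]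
  [InnerProductSpace ℂ H] {j : V →ₗ[ℂ] H} {a a' b b' : Module.End ℂ V}

theorem inner_mul_apply_eq_of_adjoint (ha : ∀ x y, ⟪j (a' x), j y⟫_ℂ = ⟪j x, j (a y)⟫_ℂ)
    (hb : ∀ x y, ⟪j (b' x), j y⟫_ℂ = ⟪j x, j (b y)⟫_ℂ) (x y : V) :
    ⟪j ((a' * b') x), j y⟫_ℂ = ⟪j x, j ((b * a) y)⟫_ℂ := by
  rw [Module.End.mul_apply, ha, hb, Module.End.mul_apply]

theorem inner_pow_apply_eq_of_adjoint (ha : ∀ x y, ⟪j (a' x), j y⟫_ℂ = ⟪j x, j (a y)⟫_ℂ) (n : ℕ)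
    (x y : V) : ⟪j ((a' ^ n) x), j y⟫_ℂ = ⟪j x, j ((a ^ n) y)⟫_ℂ := by
  induction n generalizing x y with
  | zero => simp
  | succ n ih =>
    rw [pow_succ a', pow_succ' a]
    exact inner_mul_apply_eq_of_adjoint ih ha x y

/-- Each normally ordered term is an adjoint times its operator, hence contributes a squared norm.
The terms `(0, 0)` and `(k, k)` are kept. -/
theorem norm_sq_pow_mul_pow_apply_ge
    (ha : ∀ x y, ⟪j (a' x), j y⟫_ℂ = ⟪j x, j (a y)⟫_ℂ)
    (hb : ∀ x y, ⟪j (b' x), j y⟫_ℂ = ⟪j x, j (b y)⟫_ℂ)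
    (haa : a * a' = a' * a + 1) (hbb : b * b' = b' * b + 1) (hab : Commute a b)
    (hab' : Commute a b') (ha'b : Commute a' b) {k : ℕ} (hk : 1 ≤ k)
    (x : V) :
    (k.factorial : ℝ) ^ 2 * ‖j x‖ ^ 2 + ‖j ((b ^ k * a ^ k) x)‖ ^ 2 ≤
      ‖j ((a' ^ k * b' ^ k) x)‖ ^ 2 := by
  have adj : ∀ m n x y, ⟪j ((a' ^ m * b' ^ n) x), j y⟫_ℂ = ⟪j x, j ((b ^ n * a ^ m) y)⟫_ℂ :=
    fun m n => inner_mul_apply_eq_of_adjoint (inner_pow_apply_eq_of_adjoint ha m)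
      (inner_pow_apply_eq_of_adjoint hb n)
  have ord : (b ^ k * a ^ k) * (a' ^ k * b' ^ k) =
      ∑ p ∈ Finset.range (k + 1) ×ˢ Finset.range (k + 1),
        (normalOrderCoeff k p.1 * normalOrderCoeff k p.2 : ℕ) •
          ((a' ^ p.1 * b' ^ p.2) * (b ^ p.2 * a ^ p.1)) := by
    have e : (b ^ k * a ^ k) * (a' ^ k * b' ^ k) = (a ^ k * a' ^ k) * (b ^ k * b' ^ k) := by
      rw [← (hab.pow_pow k k).eq, mul_assoc, ← mul_assoc (b ^ k), ← (ha'b.pow_pow k k).eq]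
      simp only [mul_assoc]
    rw [e, pow_mul_pow_eq_sum_normalOrderCoeff haa, pow_mul_pow_eq_sum_normalOrderCoeff hbb,
      Finset.sum_mul_sum, ← Finset.sum_product']
    refine Finset.sum_congr rfl fun p _ => ?_
    simp only [← nsmul_eq_mul, smul_mul_smul_comm]
    congr 1
    rw [mul_assoc, mul_assoc, ← mul_assoc (a ^ p.1), (hab'.pow_pow p.1 p.2).eq, mul_assoc,
      (hab.pow_pow p.1 p.2).eq]
  have key : ((‖j ((a' ^ k * b' ^ k) x)‖ ^ 2 : ℝ) : ℂ) =
      ((∑ p ∈ Finset.range (k + 1) ×ˢ Finset.range (k + 1),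
        ((normalOrderCoeff k p.1 * normalOrderCoeff k p.2 : ℕ) : ℝ) *
          ‖j ((b ^ p.2 * a ^ p.1) x)‖ ^ 2 : ℝ) : ℂ) := by
    have h1 : ((‖j ((a' ^ k * b' ^ k) x)‖ ^ 2 : ℝ) : ℂ) =
        ⟪j ((a' ^ k * b' ^ k) x), j ((a' ^ k * b' ^ k) x)⟫_ℂ := by
      rw [inner_self_eq_norm_sq_to_K]; norm_cast
    rw [h1, adj, ← Module.End.mul_apply, ord, LinearMap.sum_apply, map_sum, inner_sum,
      Complex.ofReal_sum]
    refine Finset.sum_congr rfl fun p _ => ?_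
    rw [LinearMap.smul_apply, map_nsmul, ← Nat.cast_smul_eq_nsmul ℂ, inner_smul_right,
      Module.End.mul_apply, ← inner_conj_symm, adj, inner_self_eq_norm_sq_to_K]
    simp
  rw [Complex.ofReal_inj.1 key]
  have hsub : ({(0, 0), (k, k)} : Finset (ℕ × ℕ)) ⊆
      Finset.range (k + 1) ×ˢ Finset.range (k + 1) := by
    intro p hp
    simp only [Finset.mem_insert, Finset.mem_singleton] at hp
    rcases hp with rfl | rfl <;> simp
  refine le_trans (le_of_eq ?_)
    (Finset.sum_le_sum_of_subset_of_nonneg hsub fun p _ _ => by positivity)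
  -- For `k = 0` the two retained terms would be one and the same.
  have hne : ((0, 0) : ℕ × ℕ) ≠ (k, k) := fun h => by
    have := congrArg Prod.fst h
    simp only at this
    omega
  rw [Finset.sum_pair hne]
  simp only [normalOrderCoeff_zero_right, normalOrderCoeff_self]
  simp [sq]

theorem factorial_mul_norm_le_of_commutator_eq_one
    (ha : ∀ x y, ⟪j (a' x), j y⟫_ℂ = ⟪j x, j (a y)⟫_ℂ)
    (hb : ∀ x y, ⟪j (b' x), j y⟫_ℂ = ⟪j x, j (b y)⟫_ℂ)
    (haa : a * a' = a' * a + 1) (hbb : b * b' = b' * b + 1) (hab : Commute a b)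
    (hab' : Commute a b') (ha'b : Commute a' b) {k : ℕ} (hk : 1 ≤ k)
    {α : ℝ} (hα : 1 ≤ |α|) (c : ℂ) (x : V) :
    (k.factorial : ℝ) * ‖j x‖ ≤ ‖j ((α : ℂ) • (a' ^ k * b' ^ k) x + c • x)‖ := by
  have h1 := norm_sq_pow_mul_pow_apply_ge ha hb haa hbb hab hab' ha'b hk x
  have adj : ⟪j ((a' ^ k * b' ^ k) x), j x⟫_ℂ = ⟪j x, j ((b ^ k * a ^ k) x)⟫_ℂ :=
    inner_mul_apply_eq_of_adjoint (inner_pow_apply_eq_of_adjoint ha k)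
      (inner_pow_apply_eq_of_adjoint hb k) x x
  set P := j ((a' ^ k * b' ^ k) x) with hP
  set Q := j ((b ^ k * a ^ k) x) with hQ
  set u := j x with hu
  have h2 : ‖(α : ℂ) • P + c • u‖ ^ 2 =
      α ^ 2 * ‖P‖ ^ 2 + 2 * RCLike.re ⟪(α : ℂ) • P, c • u⟫_ℂ + ‖c‖ ^ 2 * ‖u‖ ^ 2 := by
    rw [norm_add_sq (𝕜 := ℂ), norm_smul, norm_smul, mul_pow, mul_pow, Complex.norm_real,
      Real.norm_eq_abs, sq_abs]
  have h3 : |RCLike.re ⟪(α : ℂ) • P, c • u⟫_ℂ| ≤ |α| * ‖c‖ * (‖u‖ * ‖Q‖) := by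
    refine (RCLike.abs_re_le_norm _).trans ?_
    rw [inner_smul_left, inner_smul_right, adj, norm_mul, norm_mul, RCLike.norm_conj,
      Complex.norm_real, Real.norm_eq_abs, mul_assoc]
    gcongr
    exact norm_inner_le_norm _ _
  have h4 := (abs_le.1 h3).1
  have hα2 : 1 ≤ α ^ 2 := by rw [← sq_abs]; exact one_le_pow₀ hα
  have h5 : ((k.factorial : ℝ) * ‖u‖) ^ 2 ≤ ‖(α : ℂ) • P + c • u‖ ^ 2 := by
    rw [h2]
    have h6 := mul_le_mul_of_nonneg_left h1 (sq_nonneg α)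
    have h7 : 0 ≤ (α ^ 2 - 1) * ((k.factorial : ℝ) ^ 2 * ‖u‖ ^ 2) :=
      mul_nonneg (by linarith) (by positivity)
    -- The cross term is at most `2 |α| ‖c‖ ‖u‖ ‖Q‖`, which `α² ‖Q‖² + ‖c‖² ‖u‖²` dominates.
    have h8 := sq_nonneg (|α| * ‖Q‖ - ‖c‖ * ‖u‖)
    have h9 : (|α| * ‖Q‖) ^ 2 = α ^ 2 * ‖Q‖ ^ 2 := by rw [mul_pow, sq_abs]
    nlinarith
  rw [map_add, map_smul, map_smul]
  exact (pow_le_pow_iff_left₀ (by positivity) (norm_nonneg _) two_ne_zero).1 h5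

end LowerBound

/-! ### Wirtinger calculus on test functions -/

namespace WeightedDBar

open scoped ComplexConjugate

theorem fderiv_conj_apply {f : ℂ → ℂ} {z : ℂ} (hf : DifferentiableAt ℝ f z) (v : ℂ) :
    fderiv ℝ (fun w => conj (f w)) z v = conj (fderiv ℝ f z v) := by
  have h : HasFDerivAt (fun w => conj (f w))
      (Complex.conjCLE.toContinuousLinearMap ∘L fderiv ℝ f z) z :=
    Complex.conjCLE.toContinuousLinearMap.hasFDerivAt.comp z hf.hasFDerivAt
  rw [h.fderiv]
  rfl

theorem del_conj {f : ℂ → ℂ} (hf : Differentiable ℝ f) :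
    del (fun z => conj (f z)) = fun z => conj (delBar f z) := by
  funext z
  simp only [del, delBar, fderiv_conj_apply (hf z), map_mul, map_add, map_div₀, map_one,
    map_ofNat, Complex.conj_I]
  ring

theorem delBar_conj {f : ℂ → ℂ} (hf : Differentiable ℝ f) :
    delBar (fun z => conj (f z)) = fun z => conj (del f z) := by
  funext z
  simp only [del, delBar, fderiv_conj_apply (hf z), map_mul, map_sub, map_div₀, map_one,
    map_ofNat, Complex.conj_I]
  ring

/-- The weight `e^{|z|²}`, as a complex-valued function. -/
noncomputable def expWeight (z : ℂ) : ℂ := ((Real.exp (‖z‖ ^ 2) : ℝ) : ℂ)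

theorem contDiff_expWeight : ContDiff ℝ ∞ expWeight :=
  Complex.ofRealCLM.contDiff.comp (Real.contDiff_exp.comp (contDiff_norm_sq ℝ))

theorem fderiv_expWeight_apply (z v : ℂ) :
    fderiv ℝ expWeight z v = ((2 * ⟪z, v⟫_ℝ : ℝ) : ℂ) * expWeight z := by
  have h : HasFDerivAt expWeight
      (Complex.ofRealCLM ∘L (Real.exp (‖z‖ ^ 2) • 2 • innerSL ℝ z)) z :=
    Complex.ofRealCLM.hasFDerivAt.comp z (hasStrictFDerivAt_norm_sq z).hasFDerivAt.exp
  rw [h.fderiv]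
  simp [expWeight]
  ring

/-- The space `C_c^∞(ℂ)` of test functions. -/
def testSpace : Submodule ℂ (ℂ → ℂ) where
  carrier := {f | ContDiff ℝ ∞ f ∧ HasCompactSupport f}
  add_mem' hf hg := ⟨hf.1.add hg.1, hf.2.add hg.2⟩
  zero_mem' := ⟨contDiff_const, HasCompactSupport.zero⟩
  smul_mem' c _ hf := ⟨contDiff_const.smul hf.1, hf.2.smul_left (f := fun _ => c)⟩

namespace testSpace

theorem differentiable (f : testSpace) : Differentiable ℝ (f : ℂ → ℂ) :=
  f.2.1.differentiable (by simp)

theorem mul_mem {f g : ℂ → ℂ} (hg : ContDiff ℝ ∞ g) (hf : f ∈ testSpace) :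
    (fun z => g z * f z) ∈ testSpace :=
  ⟨hg.mul hf.1, hf.2.mul_left⟩

theorem conj_mem {f : ℂ → ℂ} (hf : f ∈ testSpace) : (fun z => conj (f z)) ∈ testSpace :=
  ⟨Complex.conjCLE.contDiff.comp hf.1, hf.2.comp_left (map_zero _)⟩

theorem fderiv_apply_mem {f : ℂ → ℂ} (hf : f ∈ testSpace) (v : ℂ) :
    (fun z => fderiv ℝ f z v) ∈ testSpace :=
  ⟨(hf.1.fderiv_right (m := ∞) (by simp)).clm_apply contDiff_const, hf.2.fderiv_apply ℝ v⟩

theorem integrable {f : ℂ → ℂ} (hf : f ∈ testSpace) : Integrable f :=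
  hf.1.continuous.integrable_of_hasCompactSupport hf.2

/-- The directional derivative as an operator on test functions. -/
noncomputable def dirDeriv (v : ℂ) : Module.End ℂ testSpace where
  toFun f := ⟨fun z => fderiv ℝ (f : ℂ → ℂ) z v, fderiv_apply_mem f.2 v⟩
  map_add' f g := by
    ext z
    simp [fderiv_add (differentiable f z) (differentiable g z)]
  map_smul' c f := by
    ext z
    simp [fderiv_const_smul (differentiable f z)]

/-- Multiplication by a smooth function as an operator on test functions. -/
noncomputable def mulOp (g : ℂ → ℂ) (hg : ContDiff ℝ ∞ g) : Module.End ℂ testSpace where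
  toFun f := ⟨fun z => g z * (f : ℂ → ℂ) z, mul_mem hg f.2⟩
  map_add' f g := by ext z; simp [mul_add]
  map_smul' c f := by ext z; simp [mul_left_comm]

/-- Multiplication by `z` on test functions. -/
noncomputable def mulZ : Module.End ℂ testSpace := mulOp (fun z => z) contDiff_id

/-- Multiplication by `z̄` on test functions. -/
noncomputable def mulZBar : Module.End ℂ testSpace :=
  mulOp (fun z => conj z) Complex.conjCLE.contDiff

theorem dirDeriv_apply (v : ℂ) (f : testSpace) (z : ℂ) :
    (dirDeriv v f : ℂ → ℂ) z = fderiv ℝ (f : ℂ → ℂ) z v := rfl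

theorem mulZ_apply (f : testSpace) (z : ℂ) : (mulZ f : ℂ → ℂ) z = z * (f : ℂ → ℂ) z := rfl

theorem mulZBar_apply (f : testSpace) (z : ℂ) :
    (mulZBar f : ℂ → ℂ) z = conj z * (f : ℂ → ℂ) z := rfl

theorem dirDeriv_comm (v w : ℂ) (f : testSpace) :
    dirDeriv v (dirDeriv w f) = dirDeriv w (dirDeriv v f) := by
  ext z
  have hd : DifferentiableAt ℝ (fderiv ℝ (f : ℂ → ℂ)) z :=
    ((f.2.1.fderiv_right (m := ∞) (by simp)).differentiable (by simp)) z
  have key : ∀ v w : ℂ, fderiv ℝ (fun y => fderiv ℝ (f : ℂ → ℂ) y w) z v =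
      fderiv ℝ (fderiv ℝ (f : ℂ → ℂ)) z v w := fun v w => by
    rw [fderiv_clm_apply hd (differentiableAt_const w)]
    simp
  have hs : IsSymmSndFDerivAt ℝ (f : ℂ → ℂ) z :=
    (contDiff_infty.1 f.2.1 2).contDiffAt.isSymmSndFDerivAt (by simp)
  exact (key v w).trans ((hs v w).trans (key w v).symm)

theorem mulZ_mulZBar_comm (f : testSpace) : mulZ (mulZBar f) = mulZBar (mulZ f) := by
  ext z
  exact mul_left_comm _ _ _

theorem dirDeriv_mulZ (v : ℂ) (f : testSpace) :
    dirDeriv v (mulZ f) = mulZ (dirDeriv v f) + v • f := by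
  ext z
  have h : fderiv ℝ (fun y => y * (f : ℂ → ℂ) y) z v =
      z * fderiv ℝ (f : ℂ → ℂ) z v + v * (f : ℂ → ℂ) z := by
    rw [fderiv_fun_mul differentiableAt_fun_id (differentiable f z)]
    simp [mul_comm]
  exact h

theorem dirDeriv_mulZBar (v : ℂ) (f : testSpace) :
    dirDeriv v (mulZBar f) = mulZBar (dirDeriv v f) + conj v • f := by
  ext z
  have hc : DifferentiableAt ℝ (fun w : ℂ => conj w) z := Complex.conjCLE.differentiableAt
  have h : fderiv ℝ (fun y => conj y * (f : ℂ → ℂ) y) z v =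
      conj z * fderiv ℝ (f : ℂ → ℂ) z v + conj v * (f : ℂ → ℂ) z := by
    rw [fderiv_fun_mul hc (differentiable f z)]
    have := fderiv_conj_apply (f := fun w => w) (z := z) differentiableAt_fun_id v
    simp [this, mul_comm]
  exact h

/-- `∂` as an operator on test functions. -/
noncomputable def delOp : Module.End ℂ testSpace :=
  (1 / 2 : ℂ) • (dirDeriv 1 - Complex.I • dirDeriv Complex.I)

/-- `∂̄` as an operator on test functions. -/
noncomputable def delBarOp : Module.End ℂ testSpace :=
  (1 / 2 : ℂ) • (dirDeriv 1 + Complex.I • dirDeriv Complex.I)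

theorem coe_delOp (f : testSpace) : (delOp f : ℂ → ℂ) = del f := rfl

theorem coe_delBarOp (f : testSpace) : (delBarOp f : ℂ → ℂ) = delBar f := rfl

theorem coe_delOp_pow (n : ℕ) (f : testSpace) : ((delOp ^ n) f : ℂ → ℂ) = del^[n] f := by
  induction n with
  | zero => rfl
  | succ n ih => rw [pow_succ', Module.End.mul_apply, coe_delOp, ih, Function.iterate_succ_apply']

theorem coe_delBarOp_pow (n : ℕ) (f : testSpace) :
    ((delBarOp ^ n) f : ℂ → ℂ) = delBar^[n] f := by
  induction n with
  | zero => rfl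
  | succ n ih =>
    rw [pow_succ', Module.End.mul_apply, coe_delBarOp, ih, Function.iterate_succ_apply']

theorem delOp_apply (f : testSpace) :
    delOp f = (1 / 2 : ℂ) • (dirDeriv 1 f - Complex.I • dirDeriv Complex.I f) := rfl

theorem delBarOp_apply (f : testSpace) :
    delBarOp f = (1 / 2 : ℂ) • (dirDeriv 1 f + Complex.I • dirDeriv Complex.I f) := rfl

theorem delOp_delBarOp_comm (f : testSpace) : delOp (delBarOp f) = delBarOp (delOp f) := by
  simp only [delOp_apply, delBarOp_apply, map_smul, map_add, map_sub,
    dirDeriv_comm Complex.I 1 f]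
  module

theorem delOp_mulZ (f : testSpace) : delOp (mulZ f) = mulZ (delOp f) + f := by
  simp only [delOp_apply, map_smul, map_sub, dirDeriv_mulZ, smul_add, smul_smul, Complex.I_mul_I]
  module

theorem delOp_mulZBar (f : testSpace) : delOp (mulZBar f) = mulZBar (delOp f) := by
  simp only [delOp_apply, map_smul, map_sub, dirDeriv_mulZBar, smul_add, smul_smul,
    Complex.conj_I, mul_neg, Complex.I_mul_I, map_one]
  module

theorem delBarOp_mulZBar (f : testSpace) : delBarOp (mulZBar f) = mulZBar (delBarOp f) + f := by
  simp only [delBarOp_apply, map_smul, map_add, dirDeriv_mulZBar, smul_add, smul_smul,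
    Complex.conj_I, mul_neg, Complex.I_mul_I, map_one]
  module

theorem delBarOp_mulZ (f : testSpace) : delBarOp (mulZ f) = mulZ (delBarOp f) := by
  simp only [delBarOp_apply, map_smul, map_add, dirDeriv_mulZ, smul_add, smul_smul,
    Complex.I_mul_I]
  module

/-! ### Formal adjoints and their commutators -/

/-- The adjoint `-(∂ + z̄)` of `∂̄` with respect to the weight `e^{|z|²}`. -/
noncomputable def delBarAdj : Module.End ℂ testSpace := -(delOp + mulZBar)

/-- The adjoint `-(∂̄ + z)` of `∂` with respect to the weight `e^{|z|²}`. -/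
noncomputable def delAdj : Module.End ℂ testSpace := -(delBarOp + mulZ)

theorem delBarAdj_apply (f : testSpace) : delBarAdj f = -(delOp f + mulZBar f) := rfl

theorem delAdj_apply (f : testSpace) : delAdj f = -(delBarOp f + mulZ f) := rfl

theorem delBarAdj_mul_delBarOp : delBarAdj * delBarOp = delBarOp * delBarAdj + 1 := by
  refine LinearMap.ext fun f => ?_
  change delBarAdj (delBarOp f) = delBarOp (delBarAdj f) + f
  simp only [delBarAdj_apply, map_neg, map_add, delBarOp_mulZBar, delOp_delBarOp_comm]
  abel

theorem delAdj_mul_delOp : delAdj * delOp = delOp * delAdj + 1 := by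
  refine LinearMap.ext fun f => ?_
  change delAdj (delOp f) = delOp (delAdj f) + f
  simp only [delAdj_apply, map_neg, map_add, delOp_mulZ, delOp_delBarOp_comm]
  abel

theorem delBarAdj_delAdj_comm : Commute delBarAdj delAdj := by
  refine LinearMap.ext fun f => ?_
  change delBarAdj (delAdj f) = delAdj (delBarAdj f)
  simp only [delBarAdj_apply, delAdj_apply, map_neg, map_add, delOp_mulZ, delBarOp_mulZBar,
    delOp_delBarOp_comm, mulZ_mulZBar_comm]
  abel

theorem delBarAdj_delOp_comm : Commute delBarAdj delOp := by
  refine LinearMap.ext fun f => ?_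
  change delBarAdj (delOp f) = delOp (delBarAdj f)
  simp only [delBarAdj_apply, map_neg, map_add, delOp_mulZBar]

theorem delBarOp_delAdj_comm : Commute delBarOp delAdj := by
  refine LinearMap.ext fun f => ?_
  change delBarOp (delAdj f) = delAdj (delBarOp f)
  simp only [delAdj_apply, map_neg, map_add, delBarOp_mulZ]

end testSpace

/-! ### The weighted space and integration by parts -/

instance : IsFiniteMeasureOnCompacts gaussianWeight := by
  have hle : gaussianWeight ≤ volume := by
    conv_rhs => rw [← withDensity_one (μ := (volume : Measure ℂ))]
    refine withDensity_mono (Filter.Eventually.of_forall fun z => ?_)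
    simp
  exact ⟨fun K hK => (hle K).trans_lt hK.measure_lt_top⟩

theorem integral_gaussianWeight (g : ℂ → ℂ) :
    ∫ z, g z ∂gaussianWeight = ∫ z, ((Real.exp (-‖z‖ ^ 2) : ℝ) : ℂ) * g z := by
  rw [gaussianWeight, integral_withDensity_eq_integral_toReal_smul (by fun_prop) (by simp)]
  refine integral_congr_ae (Filter.Eventually.of_forall fun z => ?_)
  simp [ENNReal.toReal_ofReal (Real.exp_pos _).le]

theorem exp_neg_mul_expWeight (z : ℂ) :
    ((Real.exp (-‖z‖ ^ 2) : ℝ) : ℂ) * expWeight z = 1 := by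
  rw [expWeight, ← Complex.ofReal_mul, ← Real.exp_add]
  simp

theorem ae_volume_of_ae_gaussianWeight {p : ℂ → Prop} (h : ∀ᵐ z ∂gaussianWeight, p z) :
    ∀ᵐ z, p z := by
  have := (ae_withDensity_iff (μ := (volume : Measure ℂ)) (by fun_prop)).1 h
  filter_upwards [this] with z hz
  exact hz (by simp [Real.exp_pos])

namespace testSpace

theorem memLp_expWeight_mul (f : testSpace) :
    MemLp (fun z => expWeight z * (f : ℂ → ℂ) z) 2 gaussianWeight :=
  have h := mul_mem contDiff_expWeight f.2
  h.1.continuous.memLp_of_hasCompactSupport h.2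

/-- The map `f ↦ e^{|z|²} f` from test functions to the weighted space. -/
noncomputable def toWeightedL2 : testSpace →ₗ[ℂ] WeightedL2 where
  toFun f := (memLp_expWeight_mul f).toLp
  map_add' f g := by
    rw [← MemLp.toLp_add]
    refine MemLp.toLp_congr _ _ (Filter.Eventually.of_forall fun z => ?_)
    simp [mul_add]
  map_smul' c f := by
    rw [RingHom.id_apply, ← MemLp.toLp_const_smul]
    refine MemLp.toLp_congr _ _ (Filter.Eventually.of_forall fun z => ?_)
    simp [mul_left_comm]

/-- The factor `e^{|z|²}` of the embedding cancels the Gaussian density. -/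
theorem inner_toWeightedL2_left (f : testSpace) (u : WeightedL2) :
    ⟪toWeightedL2 f, u⟫_ℂ = ∫ z, u z * conj ((f : ℂ → ℂ) z) := by
  rw [L2.inner_def, integral_gaussianWeight]
  refine integral_congr_ae ?_
  filter_upwards [ae_volume_of_ae_gaussianWeight (memLp_expWeight_mul f).coeFn_toLp] with z hz
  have h := exp_neg_mul_expWeight z
  have hc : conj (expWeight z) = expWeight z := Complex.conj_ofReal _
  change _ * ⟪((memLp_expWeight_mul f).toLp : ℂ → ℂ) z, u z⟫_ℂ = _
  rw [hz, RCLike.inner_apply, map_mul, hc]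
  linear_combination (u z * conj ((f : ℂ → ℂ) z)) * h

theorem inner_toWeightedL2 (f g : testSpace) :
    ⟪toWeightedL2 f, toWeightedL2 g⟫_ℂ =
      ∫ z, conj ((f : ℂ → ℂ) z) * (expWeight z * (g : ℂ → ℂ) z) := by
  rw [inner_toWeightedL2_left]
  refine integral_congr_ae ?_
  filter_upwards [ae_volume_of_ae_gaussianWeight (memLp_expWeight_mul g).coeFn_toLp] with z hz
  change ((memLp_expWeight_mul g).toLp : ℂ → ℂ) z * _ = _
  rw [hz, mul_comm]

/-- Integration by parts on compactly supported functions; differentiating `e^{|z|²}` yields the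
factor `2⟪z, v⟫ = conj v * z + v * conj z`. -/
theorem inner_toWeightedL2_dirDeriv (v : ℂ) (f g : testSpace) :
    ⟪toWeightedL2 (dirDeriv v f), toWeightedL2 g⟫_ℂ =
      -⟪toWeightedL2 f, toWeightedL2 (dirDeriv v g + conj v • mulZ g + v • mulZBar g)⟫_ℂ := by
  have hF := conj_mem f.2
  have hG := mul_mem contDiff_expWeight g.2
  have hF' : ∀ z, fderiv ℝ (fun z => conj ((f : ℂ → ℂ) z)) z v = conj (fderiv ℝ (f : ℂ → ℂ) z v) :=
    fun z => fderiv_conj_apply (differentiable f z) v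
  have hG' : ∀ z, fderiv ℝ (fun z => expWeight z * (g : ℂ → ℂ) z) z v =
      expWeight z * ((dirDeriv v g + conj v • mulZ g + v • mulZBar g : testSpace) : ℂ → ℂ) z := by
    intro z
    rw [fderiv_fun_mul (contDiff_expWeight.differentiable (by simp) z) (differentiable g z)]
    have h2 : ((2 * ⟪z, v⟫_ℝ : ℝ) : ℂ) = conj v * z + v * conj z := by
      apply Complex.ext <;> simp [Complex.inner] <;> ring
    simp only [add_apply, smul_apply, smul_eq_mul,
      fderiv_expWeight_apply, h2, Submodule.coe_add, Submodule.coe_smul, Pi.add_apply,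
      Pi.smul_apply, dirDeriv_apply, mulZ_apply, mulZBar_apply]
    ring
  have hibp := integral_mul_fderiv_eq_neg_fderiv_mul_of_integrable (μ := (volume : Measure ℂ))
    (v := v) (integrable (mul_mem (fderiv_apply_mem hF v).1 hG))
    (integrable (mul_mem hF.1 (fderiv_apply_mem hG v))) (integrable (mul_mem hF.1 hG))
    (fun z _ => (hF.1.differentiable (by simp)) z) (fun z _ => (hG.1.differentiable (by simp)) z)
  rw [inner_toWeightedL2, inner_toWeightedL2, eq_neg_iff_add_eq_zero, add_comm,
    ← eq_neg_iff_add_eq_zero]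
  simp only [hF', hG'] at hibp
  exact hibp

theorem inner_toWeightedL2_delBarOp (f g : testSpace) :
    ⟪toWeightedL2 (delBarOp f), toWeightedL2 g⟫_ℂ =
      ⟪toWeightedL2 f, toWeightedL2 (delBarAdj g)⟫_ℂ := by
  have h : delBarAdj g = (-(1 / 2 : ℂ)) • ((dirDeriv 1 g + conj (1 : ℂ) • mulZ g +
      (1 : ℂ) • mulZBar g) - Complex.I • (dirDeriv Complex.I g +
        conj Complex.I • mulZ g + Complex.I • mulZBar g)) := by
    simp only [delBarAdj, delOp, LinearMap.neg_apply, LinearMap.add_apply, LinearMap.smul_apply,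
      LinearMap.sub_apply, smul_add, smul_smul, Complex.conj_I, mul_neg, Complex.I_mul_I, map_one]
    module
  rw [h, delBarOp]
  simp only [LinearMap.smul_apply, LinearMap.add_apply, map_smul, map_sub, inner_smul_left,
    inner_smul_right, inner_sub_right]
  rw [map_add, inner_add_left, map_smul, inner_smul_left, inner_toWeightedL2_dirDeriv,
    inner_toWeightedL2_dirDeriv]
  simp only [map_div₀, map_one, map_ofNat, Complex.conj_I]
  ring

theorem inner_toWeightedL2_delOp (f g : testSpace) :
    ⟪toWeightedL2 (delOp f), toWeightedL2 g⟫_ℂ =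
      ⟪toWeightedL2 f, toWeightedL2 (delAdj g)⟫_ℂ := by
  have h : delAdj g = (-(1 / 2 : ℂ)) • ((dirDeriv 1 g + conj (1 : ℂ) • mulZ g +
      (1 : ℂ) • mulZBar g) + Complex.I • (dirDeriv Complex.I g +
        conj Complex.I • mulZ g + Complex.I • mulZBar g)) := by
    simp only [delAdj, delBarOp, LinearMap.neg_apply, LinearMap.add_apply, LinearMap.smul_apply,
      smul_add, smul_smul, Complex.conj_I, mul_neg, Complex.I_mul_I, map_one]
    module
  rw [h, delOp]
  simp only [LinearMap.smul_apply, LinearMap.sub_apply, map_smul, inner_smul_left,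
    inner_smul_right]
  rw [map_add, inner_add_right, map_smul, inner_smul_right, map_sub, inner_sub_left, map_smul,
    inner_smul_left, inner_toWeightedL2_dirDeriv, inner_toWeightedL2_dirDeriv]
  simp only [map_div₀, map_one, map_ofNat, Complex.conj_I]
  ring

/-! ### Application to the differential operator -/

/-- The operator `α ∂̄^k ∂^k + c` on test functions. -/
noncomputable def hOp (k : ℕ) (α : ℝ) (c : ℂ) : Module.End ℂ testSpace :=
  (α : ℂ) • (delBarOp ^ k * delOp ^ k) + c • 1

theorem factorial_mul_norm_toWeightedL2_le {k : ℕ} (hk : 1 ≤ k) {α : ℝ} (hα : 1 ≤ |α|) (c : ℂ)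
    (f : testSpace) :
    (k.factorial : ℝ) * ‖toWeightedL2 f‖ ≤ ‖toWeightedL2 (hOp k α c f)‖ :=
  factorial_mul_norm_le_of_commutator_eq_one inner_toWeightedL2_delBarOp inner_toWeightedL2_delOp
    delBarAdj_mul_delBarOp delAdj_mul_delOp delBarAdj_delAdj_comm delBarAdj_delOp_comm
    delBarOp_delAdj_comm hk hα c f

/-- Conjugation exchanges `∂` and `∂̄`. This reconciles the sesquilinear inner product with the
bilinear weak equation. -/
theorem conj_hOp_conj (k : ℕ) (α : ℝ) (c : ℂ) (f : testSpace) (z : ℂ) :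
    conj ((hOp k α (conj c) ⟨_, conj_mem f.2⟩ : ℂ → ℂ) z) =
      (α : ℂ) * (del^[k] (delBar^[k] f)) z + c * (f : ℂ → ℂ) z := by
  have h1 : ∀ n (g : testSpace), (delOp ^ n) ⟨_, conj_mem g.2⟩ =
      ⟨_, conj_mem ((delBarOp ^ n) g).2⟩ := by
    intro n
    induction n with
    | zero => intro g; rfl
    | succ n ih =>
      intro g
      rw [pow_succ', Module.End.mul_apply, ih, pow_succ', Module.End.mul_apply]
      exact Subtype.ext (del_conj (differentiable _))
  have h2 : ∀ n (g : testSpace), (delBarOp ^ n) ⟨_, conj_mem g.2⟩ =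
      ⟨_, conj_mem ((delOp ^ n) g).2⟩ := by
    intro n
    induction n with
    | zero => intro g; rfl
    | succ n ih =>
      intro g
      rw [pow_succ', Module.End.mul_apply, ih, pow_succ', Module.End.mul_apply]
      exact Subtype.ext (delBar_conj (differentiable _))
  rw [hOp, LinearMap.add_apply, LinearMap.smul_apply, Module.End.mul_apply, h1, h2,
    ← coe_delBarOp_pow, ← coe_delOp_pow]
  simp

end testSpace

end WeightedDBar

theorem mainTheorem6 (k : ℕ) (hk : 1 ≤ k) (α : ℝ) (hα : 1 ≤ |α|) (c : ℂ) :
    ∃ T : WeightedDBar.WeightedL2 →L[ℂ] WeightedDBar.WeightedL2,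
      (∀ f : WeightedDBar.WeightedL2, WeightedDBar.IsWeakSolution k α c (T f) f) ∧
      ‖T‖ ^ 2 ≤ 1 / (k.factorial : ℝ) ^ 2 := by
  have hfac : (0 : ℝ) < k.factorial := by exact_mod_cast k.factorial_pos
  obtain ⟨T, hT, hTf⟩ := exists_clm_inner_eq_of_norm_le WeightedDBar.testSpace.toWeightedL2
    (WeightedDBar.testSpace.toWeightedL2 ∘ₗ
      WeightedDBar.testSpace.hOp k α (starRingEnd ℂ c)) (C := 1 / (k.factorial : ℝ))
    (by positivity) (fun x => by
      rw [one_div, le_inv_mul_iff₀ hfac]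
      exact WeightedDBar.testSpace.factorial_mul_norm_toWeightedL2_le hk hα _ x)
  refine ⟨T, fun f φ hφ hφc => ?_, ?_⟩
  · let g : WeightedDBar.testSpace := ⟨φ, hφ, hφc⟩
    -- Testing against `conj φ` makes the conjugate in the inner product return `φ`, and `conj c`
    -- return `c`.
    have h := hTf ⟨_, WeightedDBar.testSpace.conj_mem g.2⟩ f
    rw [LinearMap.comp_apply, WeightedDBar.testSpace.inner_toWeightedL2_left,
      WeightedDBar.testSpace.inner_toWeightedL2_left] at h
    simp only [WeightedDBar.testSpace.conj_hOp_conj, Complex.conj_conj] at h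
    exact h
  · calc ‖T‖ ^ 2 ≤ (1 / (k.factorial : ℝ)) ^ 2 := by gcongr
      _ = 1 / (k.factorial : ℝ) ^ 2 := by rw [div_pow, one_pow]
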